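/- Let $K$ be a field of characteristic zero (for instance $\mathbb{R}$ or $\mathbb{C}$), let $m\ge 1$, and let $P(x)=c_0x^{2m}+c_1x^{2m-2}+\dots+c_m$ with $c_0,\dots,c_m\in K$, $c_0\neq 0$. Let $a_n\in K$, $n\ge -m+1$, with $a_{-m+1}=\dots=a_0=0$, and let $\mathbf J$ be the semi-infinite symmetric tridiagonal (Jacobi) matrix, with rows and columns indexed by $0,1,2,\dots$, with zero diagonal $b_0=b_1=\dots=0$ and with off-diagonal entries $\mathbf J_{n-1,n}=\mathbf J_{n,n-1}=a_n$, $n\ge1$. Freud's equations for $(a_n)$ are $$a_n\,(P'(\mathbf J))_{n,n-1}=n,\qquad n=1,2,\dots \tag{F}$$ (i) For every $\mu_0\in K\setminus\{0\}$ there is exactly one sequence $(\mu_j)_{j\ge0}$ in $K$ beginning with $\mu_0$ such that $\mu_{2j+1}=0$ for all $j\ge0$, $$2mc_0\,\mu_{2n+2m}+(2m-2)c_1\,\mu_{2n+2m-2}+\dots+2c_{m-1}\,\mu_{2n+2}=(2n+1)\,\mu_{2n},\qquad n=0,1,\dots,$$ and $\mu_{2j}/\mu_0=(\mathbf J^{2j})_{0,0}$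 for $j=1,\dots,m-1$. The numbers $(\mathbf J^{2j})_{0,0}$, $0\le j\le m-1$, depend only on the initial data $a_1,\dots,a_{m-1}$. (ii) Let $(\mu_j)$ be such a sequence, let $H_n=\det(\mu_{i+j})_{0\le i,j\le n-1}$ with $H_0=1$, and let $\tilde H_n$ be the determinant obtained from $H_n$ by replacing its last column by $(\mu_n,\dots,\mu_{2n-1})^{T}$, with $\tilde H_0=0$. Then $(a_n)$ satisfies Freud's equations (F) if and only if $H_n\ne0$ for all $n\ge0$ and $$a_n^2=\frac{H_{n-1}H_{n+1}}{H_n^2}\quad(n\ge1),\qquad 0=b_n=\frac{\tilde H_{n+1}}{H_{n+1}}-\frac{\tilde H_n}{H_n}\quad(n\ge0).$$ -/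

import Mathlib

noncomputable section

namespace Freud

open Polynomial

variable {K : Type*} [Field K]

/-- The semi-infinite Jacobi matrix, rows and columns indexed by `0, 1, 2, …`, with diagonal
`b 0, b 1, …` and off-diagonal entries `a 1, a 2, …`, as an endomorphism of the space of finitely
supported sequences: column `j` holds `a (j+1)` in row `j+1`, `b j` in row `j` and, if `j ≥ 1`,
`a j` in row `j-1`. Composition of such endomorphisms is the product of (column-finite) infinite
matrices. The values of `a` at nonpositive indices do not occur. -/
def jacobi (a : ℤ → K) (b : ℕ → K) : Module.End K (ℕ →₀ K) :=
  Finsupp.linearCombination K fun j : ℕ =>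
    Finsupp.single (j + 1) (a (j + 1)) + Finsupp.single j (b j) +
      (if 1 ≤ j then Finsupp.single (j - 1) (a j) else 0)

/-- The entry in row `i` and column `j` of the infinite matrix of `T`. -/
def entry (T : Module.End K (ℕ →₀ K)) (i j : ℕ) : K :=
  T (Finsupp.single j 1) i

/-- The polynomial `c 0 * X ^ (2m) + c 1 * X ^ (2m-2) + ⋯ + c m`. -/
def evenPoly (m : ℕ) (c : ℕ → K) : K[X] :=
  ∑ i ∈ Finset.range (m + 1), C (c i) * X ^ (2 * (m - i))

/-- `F_n(a) = a_n (P'(J))_{n,n-1}`, where `J` is the Jacobi matrix with zero diagonal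
(used for `n ≥ 1`). -/
def freudF (P : K[X]) (a : ℤ → K) (n : ℕ) : K :=
  a n * entry (aeval (jacobi a 0) (derivative P)) n (n - 1)

/-- Freud's equations `F_n(a) = n`, `n = 1, 2, …`. -/
def SolvesFreud (P : K[X]) (a : ℤ → K) : Prop :=
  ∀ n : ℕ, 1 ≤ n → freudF P a n = n

/-- The Hankel determinant `H_n` with entries `μ (i + j)`, `0 ≤ i, j ≤ n - 1`; `H_0 = 1`. -/
def hankelDet (μ : ℕ → K) (n : ℕ) : K :=
  (Matrix.of fun i j : Fin n => μ (i + j)).det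

/-- The determinant obtained from `H_n` by replacing the last column
`μ (n-1), …, μ (2n-2)` by `μ n, …, μ (2n-1)`, with value `0` at `n = 0`. -/
def hankelDetTilde (μ : ℕ → K) (n : ℕ) : K :=
  if n = 0 then 0 else
    (Matrix.of fun i j : Fin n => μ (i + if (j : ℕ) + 1 = n then n else (j : ℕ))).det

/-- The recurrence coefficients `a_n` (`n ≥ 1`) and `b_n` (`n ≥ 0`) are given by the
Hankel determinants of `μ`, none of which vanishes. -/
def GivenByHankel (μ : ℕ → K) (a : ℤ → K) (b : ℕ → K) : Prop :=
  (∀ n, hankelDet μ n ≠ 0) ∧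
  (∀ n : ℕ, 1 ≤ n →
    a n ^ 2 = hankelDet μ (n - 1) * hankelDet μ (n + 1) / hankelDet μ n ^ 2) ∧
  (∀ n : ℕ, b n = hankelDetTilde μ (n + 1) / hankelDet μ (n + 1) -
    hankelDetTilde μ n / hankelDet μ n)

/-- The odd moments vanish and, for `n = 0, 1, …`,
`2m c_0 μ_{2n+2m} + (2m-2) c_1 μ_{2n+2m-2} + ⋯ + 2 c_{m-1} μ_{2n+2} = (2n+1) μ_{2n}`. -/
def MomentRecurrence (m : ℕ) (c : ℕ → K) (μ : ℕ → K) : Prop :=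
  (∀ j, μ (2 * j + 1) = 0) ∧
  ∀ n : ℕ, ∑ i ∈ Finset.range m,
    ((2 * (m - i) : ℕ) : K) * c i * μ (2 * n + 2 * (m - i)) = (2 * n + 1 : K) * μ (2 * n)

/-- The initial moments: `μ_{2j} / μ_0 = (J^{2j})_{0,0}` for `j = 1, …, m - 1`. -/
def InitialMoments (m : ℕ) (a : ℤ → K) (μ : ℕ → K) : Prop :=
  ∀ j : ℕ, 1 ≤ j → j < m → μ (2 * j) / μ 0 = entry (jacobi a 0 ^ (2 * j)) 0 0

end Freud

end

/-!
Let `Λ f = (f(J))_{0,0}` and let `p n` be the monic orthogonal polynomials of `J`, so that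
`p n (J) e₀ = a 1 ⋯ a n e_n`. For `Q = P'` the defect `Λ (Q f) - Λ (f')` equals
`(a 1 ⋯ a n)² Q(J)_{n,n}` at `f = p n * p n` and
`(a 1 ⋯ a n)² (a (n+1) Q(J)_{n+1,n} - (n+1))` at `f = p n * p (n+1)`. These products form a basis
of the polynomials, the `a n` are nonzero by Freud's equations or by the determinantal formulas,
and `Q(J)` has zero diagonal because `Q` is odd. Hence Freud's equations say exactly that the
defect vanishes. Tested on the powers of `X`, this is the moment recurrence for
the moments of `J`.

The determinants `H_n` and `H̃_n` of the moments of `J` follow from the factorization of the Hankel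
matrix through the triangular matrix `(J ^ j e₀)_k`. Conversely, `H_{n+1}` and `H̃_{n+1}` are affine
in the moments `μ (2n)` and `μ (2n+1)` with leading coefficient `H_n`, so the determinantal
formulas for `a` and `b` force `μ` to be proportional to the moments of `J`.
-/

noncomputable section

namespace Freud

open Polynomial
open Finset (range)
open Finsupp (single)

section LinearRecurrence

variable {K : Type*} [Field K]

theorem existsUnique_of_forall_lt_congr {E : Type*} [Nonempty E] (F : (ℕ → E) → ℕ → E)
    (hF : ∀ s t k, (∀ j < k, s j = t j) → F s k = F t k) : ∃! s, F s = s := by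
  let s : ℕ → E := wellFounded_lt.fix fun k rec =>
    F (fun j => if h : j < k then rec j h else Classical.arbitrary E) k
  have hs : F s = s := by
    funext k
    rw [show s k = _ from wellFounded_lt.fix_eq _ k]
    exact hF _ _ k fun j hj => by rw [dif_pos hj]
  refine ⟨s, hs, fun t ht => funext fun k => ?_⟩
  induction k using Nat.strong_induction_on with
  | _ k ih => rw [← ht, ← hs, hF t s k ih]

theorem existsUnique_linearRecurrence (m : ℕ) (d : ℕ → ℕ → K) (hd : ∀ n, d n m ≠ 0)
    (init : ℕ → K) :
    ∃! s : ℕ → K, (∀ j < m, s j = init j) ∧ ∀ n, ∑ i ∈ range (m + 1), d n i * s (n + i) = 0 := by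
  let F (s : ℕ → K) (k : ℕ) : K :=
    if k < m then init k
    else -(∑ i ∈ range m, d (k - m) i * s (k - m + i)) / d (k - m) m
  have hF : ∀ s t k, (∀ j < k, s j = t j) → F s k = F t k := by
    intro s t k h
    by_cases hk : k < m
    · simp only [F, hk, if_true]
    · simp only [F, hk, if_false]
      congr 2
      refine Finset.sum_congr rfl fun i hi => ?_
      rw [h _ (by have := Finset.mem_range.1 hi; omega)]
  refine (existsUnique_congr fun s => ?_).1 (existsUnique_of_forall_lt_congr F hF)
  have hlow : ∀ j < m, F s j = init j := fun j hj => if_pos hj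
  have hhigh : ∀ n, F s (n + m) = s (n + m) ↔ ∑ i ∈ range (m + 1), d n i * s (n + i) = 0 := by
    intro n
    simp only [F, Nat.not_lt.2 (Nat.le_add_left m n), if_false, Nat.add_sub_cancel]
    rw [div_eq_iff (hd n), Finset.sum_range_succ, neg_eq_iff_add_eq_zero, mul_comm (s _)]
  constructor
  · intro hs
    exact ⟨fun j hj => by rw [← hlow j hj, hs], fun n => (hhigh n).1 (congrFun hs _)⟩
  · rintro ⟨hinit, hrec⟩
    funext k
    rcases lt_or_ge k m with hk | hk
    · rw [hlow k hk, hinit k hk]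
    · obtain ⟨n, rfl⟩ := Nat.exists_eq_add_of_le' hk
      exact (hhigh n).2 (hrec n)

end LinearRecurrence

section CommRing

variable {R : Type*} [CommRing R]

theorem isSelfAdjoint_aeval {M : Type*} [AddCommGroup M] [Module R M]
    {B : LinearMap.BilinForm R M} {T : Module.End R M} (hT : B.IsSelfAdjoint T) (f : R[X]) :
    B.IsSelfAdjoint (aeval T f) := by
  induction f using Polynomial.induction_on with
  | C r =>
    intro x y
    simp
  | add p q hp hq =>
    rw [map_add]
    exact LinearMap.IsAdjointPair.add hp hq
  | monomial n r ih =>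
    have hleft : aeval T (C r * X ^ (n + 1)) = T * aeval T (C r * X ^ n) := by
      rw [pow_succ', mul_left_comm, map_mul, aeval_X]
    have hright : aeval T (C r * X ^ (n + 1)) = aeval T (C r * X ^ n) * T := by
      rw [pow_succ, ← mul_assoc, map_mul, aeval_X]
    intro x y
    rw [hleft, Module.End.mul_apply, hT, ih, ← Module.End.mul_apply, ← hright, hleft]

/-- The standard symmetric bilinear form `∑ i, x i * y i` on finitely supported sequences, for
which the Jacobi matrices are self-adjoint. -/
def stdForm : LinearMap.BilinForm R (ℕ →₀ R) :=
  Finsupp.basisSingleOne.toDual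

theorem stdForm_single_left (i : ℕ) (x : R) (y : ℕ →₀ R) :
    stdForm (single i x) y = x * y i := by
  rw [← Finsupp.smul_single_one, map_smul, LinearMap.smul_apply, smul_eq_mul]
  exact congrArg (x * ·) (Finsupp.basisSingleOne.toDual_apply_right i y)

theorem stdForm_single_right (x : ℕ →₀ R) (i : ℕ) (y : R) :
    stdForm x (single i y) = x i * y := by
  rw [← Finsupp.smul_single_one, map_smul, smul_eq_mul, mul_comm]
  exact congrArg (· * y) (Finsupp.basisSingleOne.toDual_apply_left x i)

theorem stdForm_eq_sum_range {x : ℕ →₀ R} (y : ℕ →₀ R) {n : ℕ} (hx : ∀ k, n ≤ k → x k = 0) :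
    stdForm x y = ∑ k ∈ range n, x k * y k := by
  have hsupp : x.support ⊆ range n := fun k hk =>
    Finset.mem_range.2 (not_le.1 fun h => Finsupp.mem_support_iff.1 hk (hx k h))
  conv_lhs => rw [← x.sum_single]
  rw [Finsupp.sum_of_support_subset x hsupp _ fun _ _ => Finsupp.single_zero _, map_sum,
    LinearMap.sum_apply]
  simp only [stdForm_single_left]

/-- The product `a 1 * ⋯ * a n`, the entry `(J ^ n)_{n,0}` of a Jacobi matrix `J`. -/
def coeffProd (a : ℤ → R) (n : ℕ) : R := ∏ k ∈ range n, a (k + 1)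

theorem coeffProd_zero (a : ℤ → R) : coeffProd a 0 = 1 := Finset.prod_range_zero _

theorem coeffProd_succ (a : ℤ → R) (n : ℕ) : coeffProd a (n + 1) = coeffProd a n * a (n + 1) :=
  Finset.prod_range_succ _ _

theorem coeffProd_ne_zero [Nontrivial R] [NoZeroDivisors R] {a : ℤ → R}
    (ha : ∀ n : ℕ, a (n + 1) ≠ 0) (n : ℕ) : coeffProd a n ≠ 0 :=
  Finset.prod_ne_zero_iff.2 fun k _ => ha k

end CommRing

section Jacobi

variable {K : Type*} [Field K] (a : ℤ → K) (b : ℕ → K)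

theorem jacobi_single_zero (x : K) :
    jacobi a b (single 0 x) = single 1 (x * a 1) + single 0 (x * b 0) := by
  simp [jacobi]

theorem jacobi_single_succ (j : ℕ) (x : K) :
    jacobi a b (single (j + 1) x) =
      single (j + 2) (x * a (j + 1 + 1)) + single (j + 1) (x * b (j + 1)) +
        single j (x * a (j + 1)) := by
  simp [jacobi]

theorem entry_jacobi_comm (i j : ℕ) : entry (jacobi a b) i j = entry (jacobi a b) j i := by
  unfold entry
  rcases i with _ | i <;> rcases j with _ | j <;>
    simp only [jacobi_single_zero, jacobi_single_succ, Finsupp.add_apply, Finsupp.single_apply] <;>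
    grind

theorem isSelfAdjoint_jacobi : stdForm.IsSelfAdjoint (jacobi a b) := by
  rw [LinearMap.IsSelfAdjoint, LinearMap.isAdjointPair_iff_comp_eq_compl₂]
  ext i j
  simpa [stdForm_single_left, stdForm_single_right, entry] using entry_jacobi_comm a b j i

theorem jacobi_apply_zero (w : ℕ →₀ K) : jacobi a b w 0 = a 1 * w 1 + b 0 * w 0 := by
  rw [← one_mul (jacobi a b w 0), ← stdForm_single_left, ← isSelfAdjoint_jacobi,
    jacobi_single_zero]
  simp only [map_add, LinearMap.add_apply, stdForm_single_left, one_mul]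

theorem jacobi_apply_succ (w : ℕ →₀ K) (i : ℕ) :
    jacobi a b w (i + 1) =
      a (i + 1 + 1) * w (i + 2) + b (i + 1) * w (i + 1) + a (i + 1) * w i := by
  rw [← one_mul (jacobi a b w _), ← stdForm_single_left, ← isSelfAdjoint_jacobi,
    jacobi_single_succ]
  simp only [map_add, LinearMap.add_apply, stdForm_single_left, one_mul]

theorem entry_aeval_jacobi_mul (f g : K[X]) (i j : ℕ) :
    entry (aeval (jacobi a b) (f * g)) i j =
      stdForm (aeval (jacobi a b) f (single i 1)) (aeval (jacobi a b) g (single j 1)) := by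
  rw [isSelfAdjoint_aeval (isSelfAdjoint_jacobi a b), stdForm_single_left, one_mul, map_mul]
  rfl

theorem jacobi_pow_single_zero_apply_of_lt {k i : ℕ} (h : k < i) :
    (jacobi a b ^ k) (single 0 1) i = 0 := by
  induction k generalizing i with
  | zero => simp [h.ne]
  | succ k ih =>
    obtain ⟨i, rfl⟩ := Nat.exists_eq_succ_of_ne_zero (Nat.ne_zero_of_lt h)
    rw [pow_succ', Module.End.mul_apply, Nat.succ_eq_add_one, jacobi_apply_succ,
      ih (by omega), ih (by omega), ih (by omega)]
    ring

theorem jacobi_pow_single_zero_apply_self (k : ℕ) :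
    (jacobi a b ^ k) (single 0 1) k = coeffProd a k := by
  induction k with
  | zero => simp [coeffProd_zero]
  | succ k ih =>
    rw [pow_succ', Module.End.mul_apply, jacobi_apply_succ, ih, coeffProd_succ,
      jacobi_pow_single_zero_apply_of_lt a b (by omega : k < k + 2),
      jacobi_pow_single_zero_apply_of_lt a b (by omega : k < k + 1)]
    ring

theorem jacobi_pow_succ_single_zero_apply (k : ℕ) :
    (jacobi a b ^ (k + 1)) (single 0 1) k = coeffProd a k * ∑ i ∈ range (k + 1), b i := by
  induction k with
  | zero => simp [coeffProd_zero, jacobi_apply_zero]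
  | succ k ih =>
    rw [pow_succ', Module.End.mul_apply, jacobi_apply_succ, ih,
      jacobi_pow_single_zero_apply_self, jacobi_pow_single_zero_apply_of_lt a b (by omega),
      Finset.sum_range_succ _ (k + 1), coeffProd_succ]
    ring

theorem aeval_jacobi_single_zero_apply {f : K[X]} {n : ℕ} (hf : f.natDegree ≤ n) :
    aeval (jacobi a b) f (single 0 1) n = f.coeff n * coeffProd a n := by
  rw [aeval_eq_sum_range' (Nat.lt_succ_of_le hf), LinearMap.sum_apply, Finsupp.finsetSum_apply,
    Finset.sum_range_succ, Finset.sum_eq_zero]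
  · simp [jacobi_pow_single_zero_apply_self]
  · intro k hk
    simp [jacobi_pow_single_zero_apply_of_lt a b (Finset.mem_range.1 hk)]

variable {a b} in
theorem jacobi_pow_single_zero_congr {a' : ℤ → K} {b' : ℕ → K} {k : ℕ}
    (ha : ∀ n < k, a' (n + 1) = a (n + 1)) (hb : ∀ n < k, b' n = b n) :
    (jacobi a' b' ^ k) (single 0 1) = (jacobi a b ^ k) (single 0 1) := by
  induction k with
  | zero => rfl
  | succ k ih =>
    rw [pow_succ', pow_succ', Module.End.mul_apply, Module.End.mul_apply,
      ih (fun n hn => ha n (by omega)) (fun n hn => hb n (by omega)),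
      ← Finsupp.sum_single ((jacobi a b ^ k) (single 0 1)), map_finsuppSum, map_finsuppSum]
    refine Finsupp.sum_congr fun i hi => ?_
    have hik : i ≤ k := not_lt.1 fun h =>
      Finsupp.mem_support_iff.1 hi (jacobi_pow_single_zero_apply_of_lt a b h)
    rcases i with _ | i
    · have ha₁ := ha 0 (by omega)
      rw [Nat.cast_zero, zero_add] at ha₁
      rw [jacobi_single_zero, jacobi_single_zero, ha₁, hb 0 (by omega)]
    · have ha₂ := ha (i + 1) (by omega)
      rw [Nat.cast_add_one] at ha₂
      rw [jacobi_single_succ, jacobi_single_succ, ha i (by omega), ha₂, hb (i + 1) (by omega)]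

theorem entry_jacobi_pow_eq_zero_of_odd {k i j : ℕ} (h : Odd (i + j + k)) :
    entry (jacobi a 0 ^ k) i j = 0 := by
  induction k generalizing i with
  | zero =>
    have hij : j ≠ i := by grind
    simp [entry, hij]
  | succ k ih =>
    have hstep : ∀ r, Odd (r + j + k) → (jacobi a 0 ^ k) (single j 1) r = 0 := fun r hr => ih hr
    rw [entry, pow_succ', Module.End.mul_apply]
    rcases i with _ | i
    · rw [jacobi_apply_zero, hstep 1 (by grind), Pi.zero_apply]
      ring
    · rw [jacobi_apply_succ, hstep i (by grind), hstep (i + 2) (by grind), Pi.zero_apply]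
      ring

end Jacobi

section Hankel

variable {K : Type*} [Field K]

theorem det_sub_det_of_eq_off_last {R : Type*} [CommRing R] {n : ℕ}
    {A B : Matrix (Fin (n + 1)) (Fin (n + 1)) R}
    (h : ∀ i j, i ≠ Fin.last n ∨ j ≠ Fin.last n → A i j = B i j) :
    A.det - B.det = (A (Fin.last n) (Fin.last n) - B (Fin.last n) (Fin.last n)) *
      (A.submatrix Fin.castSucc Fin.castSucc).det := by
  have hminor (j : Fin (n + 1)) :
      B.submatrix (Fin.last n).succAbove j.succAbove =
        A.submatrix (Fin.last n).succAbove j.succAbove := by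
    ext i k
    exact (h _ _ (Or.inl (Fin.succAbove_ne _ _))).symm
  rw [Matrix.det_succ_row A (Fin.last n), Matrix.det_succ_row B (Fin.last n),
    ← Finset.sum_sub_distrib, Fin.sum_univ_castSucc, Finset.sum_eq_zero]
  · rw [hminor]
    simp only [Fin.succAbove_last, Fin.val_last, ← two_mul, pow_mul, neg_one_sq, one_pow]
    ring
  · intro j _
    rw [hminor, h _ _ (Or.inr (Fin.castSucc_ne_last j)), sub_self]

theorem hankelDet_zero (μ : ℕ → K) : hankelDet μ 0 = 1 := Matrix.det_isEmpty

theorem hankelDet_one (μ : ℕ → K) : hankelDet μ 1 = μ 0 := Matrix.det_fin_one _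

theorem hankelDetTilde_zero (μ : ℕ → K) : hankelDetTilde μ 0 = 0 := if_pos rfl

theorem hankelDetTilde_succ (μ : ℕ → K) (n : ℕ) :
    hankelDetTilde μ (n + 1) =
      (Matrix.of fun i j : Fin (n + 1) => μ (i + if (j : ℕ) = n then n + 1 else j)).det := by
  simp only [hankelDetTilde, Nat.add_one_ne_zero, if_false, Nat.add_right_cancel_iff]

theorem hankelDet_smul (r : K) (μ : ℕ → K) (n : ℕ) :
    hankelDet (r • μ) n = r ^ n * hankelDet μ n := by
  have hsmul := Matrix.det_smul (Matrix.of fun i j : Fin n => μ (i + j)) r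
  rwa [Fintype.card_fin] at hsmul

theorem hankelDetTilde_smul (r : K) (μ : ℕ → K) (n : ℕ) :
    hankelDetTilde (r • μ) n = r ^ n * hankelDetTilde μ n := by
  rcases n with _ | n
  · rw [hankelDetTilde_zero, hankelDetTilde_zero, mul_zero]
  · rw [hankelDetTilde_succ, hankelDetTilde_succ]
    have hsmul := Matrix.det_smul
      (Matrix.of fun i j : Fin (n + 1) => μ (i + if (j : ℕ) = n then n + 1 else j)) r
    rwa [Fintype.card_fin] at hsmul

theorem hankelDet_succ_sub_hankelDet_succ {μ ν : ℕ → K} {n : ℕ} (h : ∀ j < 2 * n, μ j = ν j) :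
    hankelDet μ (n + 1) - hankelDet ν (n + 1) = (μ (2 * n) - ν (2 * n)) * hankelDet μ n := by
  rw [hankelDet, hankelDet, det_sub_det_of_eq_off_last, two_mul]
  · rfl
  · intro i j hij
    exact h _ (by simp only [ne_eq, Fin.ext_iff, Fin.val_last] at hij; omega)

theorem hankelDetTilde_succ_sub_hankelDetTilde_succ {μ ν : ℕ → K} {n : ℕ}
    (h : ∀ j < 2 * n + 1, μ j = ν j) :
    hankelDetTilde μ (n + 1) - hankelDetTilde ν (n + 1) =
      (μ (2 * n + 1) - ν (2 * n + 1)) * hankelDet μ n := by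
  have hminor : (Matrix.of fun i j : Fin (n + 1) =>
      μ (i + if (j : ℕ) = n then n + 1 else j)).submatrix Fin.castSucc Fin.castSucc =
        Matrix.of fun i j : Fin n => μ (i + j) := by
    ext i j
    simp [j.2.ne]
  rw [hankelDetTilde_succ, hankelDetTilde_succ, det_sub_det_of_eq_off_last, hminor, hankelDet]
  · simp [two_mul, add_assoc]
  · intro i j hij
    exact h _ (by simp only [ne_eq, Fin.ext_iff, Fin.val_last] at hij; split <;> omega)

variable {a : ℤ → K} {b : ℕ → K}

namespace GivenByHankel

variable {μ ν : ℕ → K}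

theorem smul {r : K} (hr : r ≠ 0) (h : GivenByHankel μ a b) : GivenByHankel (r • μ) a b := by
  obtain ⟨hne, ha, hb⟩ := h
  simp only [GivenByHankel, hankelDet_smul, hankelDetTilde_smul]
  refine ⟨fun n => mul_ne_zero (pow_ne_zero n hr) (hne n), fun n hn => ?_, fun n => ?_⟩
  · obtain ⟨n, rfl⟩ := Nat.exists_eq_add_of_le' hn
    rw [ha _ hn, Nat.add_sub_cancel, mul_pow]
    field_simp
    ring
  · rw [hb n, mul_div_mul_left _ _ (pow_ne_zero _ hr), mul_div_mul_left _ _ (pow_ne_zero _ hr)]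

theorem coeff_ne_zero (h : GivenByHankel μ a b) (n : ℕ) : a (n + 1) ≠ 0 := by
  obtain ⟨hne, ha, -⟩ := h
  have hsq := ha (n + 1) n.succ_pos
  rw [Nat.cast_add_one] at hsq
  refine pow_ne_zero_iff two_ne_zero |>.1 (hsq ▸ ?_)
  exact div_ne_zero (mul_ne_zero (hne _) (hne _)) (pow_ne_zero 2 (hne _))

theorem hankelDet_eq (hμ : GivenByHankel μ a b) (hν : GivenByHankel ν a b) (h₀ : μ 0 = ν 0)
    (n : ℕ) : hankelDet μ n = hankelDet ν n := by
  induction n using Nat.twoStepInduction with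
  | zero => rw [hankelDet_zero, hankelDet_zero]
  | one => rw [hankelDet_one, hankelDet_one, h₀]
  | more n ih₁ ih₂ =>
    have hquot := (hμ.2.1 (n + 1) n.succ_pos).symm.trans (hν.2.1 (n + 1) n.succ_pos)
    rw [Nat.add_sub_cancel, ih₁, ih₂, div_left_inj' (pow_ne_zero 2 (hν.1 _))] at hquot
    exact mul_left_cancel₀ (hν.1 n) hquot

theorem hankelDetTilde_eq (hμ : GivenByHankel μ a b) (hν : GivenByHankel ν a b) (h₀ : μ 0 = ν 0)
    (n : ℕ) : hankelDetTilde μ n = hankelDetTilde ν n := by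
  induction n with
  | zero => rw [hankelDetTilde_zero, hankelDetTilde_zero]
  | succ n ih =>
    have hdiff := (hμ.2.2 n).symm.trans (hν.2.2 n)
    rwa [hμ.hankelDet_eq hν h₀, hμ.hankelDet_eq hν h₀, ih, sub_left_inj,
      div_left_inj' (hν.1 _)] at hdiff

theorem unique (hμ : GivenByHankel μ a b) (hν : GivenByHankel ν a b) (h₀ : μ 0 = ν 0) :
    μ = ν := by
  funext j
  induction j using Nat.strong_induction_on with
  | _ j ih =>
    rcases Nat.even_or_odd' j with ⟨n, rfl | rfl⟩
    · have hdiff := hankelDet_succ_sub_hankelDet_succ ih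
      rw [hμ.hankelDet_eq hν h₀, sub_self, eq_comm] at hdiff
      exact sub_eq_zero.1 ((mul_eq_zero.1 hdiff).resolve_right (hμ.1 n))
    · have hdiff := hankelDetTilde_succ_sub_hankelDetTilde_succ ih
      rw [hμ.hankelDetTilde_eq hν h₀, sub_self, eq_comm] at hdiff
      exact sub_eq_zero.1 ((mul_eq_zero.1 hdiff).resolve_right (hμ.1 n))

end GivenByHankel

/-- The moments `(J ^ k)_{0,0}` of the spectral measure of the Jacobi matrix `J`, normalized by
`(J ^ 0)_{0,0} = 1`. -/
def jacobiMoment (a : ℤ → K) (b : ℕ → K) (k : ℕ) : K :=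
  entry (jacobi a b ^ k) 0 0

variable (a b)

theorem jacobiMoment_zero : jacobiMoment a b 0 = 1 := by
  simp [jacobiMoment, entry]

theorem jacobiMoment_add (i j : ℕ) :
    jacobiMoment a b (i + j) =
      stdForm ((jacobi a b ^ i) (single 0 1)) ((jacobi a b ^ j) (single 0 1)) := by
  simpa [jacobiMoment, ← pow_add] using entry_aeval_jacobi_mul a b (X ^ i) (X ^ j) 0 0

variable {a b} in
theorem jacobiMoment_two_mul_congr {a' : ℤ → K} {b' : ℕ → K} {k : ℕ}
    (ha : ∀ n < k, a' (n + 1) = a (n + 1)) (hb : ∀ n < k, b' n = b n) :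
    jacobiMoment a' b' (2 * k) = jacobiMoment a b (2 * k) := by
  rw [two_mul, jacobiMoment_add, jacobiMoment_add, jacobi_pow_single_zero_congr ha hb]

theorem jacobiMoment_eq_zero_of_odd {k : ℕ} (hk : Odd k) : jacobiMoment a 0 k = 0 :=
  entry_jacobi_pow_eq_zero_of_odd a (by simpa using hk)

/-- Choosing the exponents `σ j = j` gives the determinant `H_n`, and replacing the last of them
by `n` gives the determinant `H̃_n`. -/
theorem det_jacobiMoment_add {n : ℕ} (σ : Fin n → ℕ) :
    (Matrix.of fun i j : Fin n => jacobiMoment a b (i + σ j)).det =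
      (∏ k ∈ range n, coeffProd a k) *
        (Matrix.of fun k j : Fin n => (jacobi a b ^ σ j) (single 0 1) k).det := by
  let M : Matrix (Fin n) (Fin n) K := Matrix.of fun i k => (jacobi a b ^ (i : ℕ)) (single 0 1) k
  have hM : M.det = ∏ k ∈ range n, coeffProd a k := by
    rw [Matrix.det_of_isLowerTriangular, Finset.prod_range]
    · exact Finset.prod_congr rfl fun i _ => jacobi_pow_single_zero_apply_self a b i
    · exact fun i k hik => jacobi_pow_single_zero_apply_of_lt a b hik
  rw [← hM, ← Matrix.det_mul]
  congr 1
  ext i j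
  rw [Matrix.of_apply, jacobiMoment_add, stdForm_eq_sum_range (n := n), Matrix.mul_apply,
    Finset.sum_range]
  · rfl
  · exact fun k hk => jacobi_pow_single_zero_apply_of_lt a b (i.2.trans_le hk)

theorem hankelDet_jacobiMoment (n : ℕ) :
    hankelDet (jacobiMoment a b) n = (∏ k ∈ range n, coeffProd a k) ^ 2 := by
  rw [hankelDet, det_jacobiMoment_add, sq, Matrix.det_of_isUpperTriangular]
  · simp only [Matrix.of_apply, jacobi_pow_single_zero_apply_self, Finset.prod_range]
  · exact fun k j hkj => jacobi_pow_single_zero_apply_of_lt a b hkj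

theorem hankelDetTilde_jacobiMoment (n : ℕ) :
    hankelDetTilde (jacobiMoment a b) n =
      hankelDet (jacobiMoment a b) n * ∑ k ∈ range n, b k := by
  rcases n with _ | n
  · rw [hankelDetTilde_zero, Finset.sum_range_zero, mul_zero]
  · rw [hankelDetTilde_succ, det_jacobiMoment_add, hankelDet_jacobiMoment, sq, mul_assoc,
      Matrix.det_of_isUpperTriangular]
    · simp only [Matrix.of_apply, Fin.prod_univ_castSucc, Fin.val_castSucc, Fin.val_last, if_true,
        (Fin.is_lt _).ne, if_false, jacobi_pow_single_zero_apply_self,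
        jacobi_pow_succ_single_zero_apply, Finset.prod_range_succ _ n, Finset.prod_range, mul_assoc]
    · intro k j hkj
      have hj : (j : ℕ) ≠ n := ((Fin.lt_def.1 hkj).trans_le (Fin.is_le k)).ne
      simp only [Matrix.of_apply, hj, if_false]
      exact jacobi_pow_single_zero_apply_of_lt a b hkj

variable {a} in
theorem givenByHankel_jacobiMoment (ha : ∀ n : ℕ, a (n + 1) ≠ 0) :
    GivenByHankel (jacobiMoment a b) a b := by
  have hprod (n : ℕ) : ∏ k ∈ range n, coeffProd a k ≠ 0 :=
    Finset.prod_ne_zero_iff.2 fun k _ => coeffProd_ne_zero ha k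
  have hne (n : ℕ) : hankelDet (jacobiMoment a b) n ≠ 0 := by
    rw [hankelDet_jacobiMoment]
    exact pow_ne_zero 2 (hprod n)
  refine ⟨hne, fun n hn => ?_, fun n => ?_⟩
  · obtain ⟨n, rfl⟩ := Nat.exists_eq_add_of_le' hn
    rw [Nat.add_sub_cancel, eq_div_iff (pow_ne_zero 2 (hne _))]
    simp only [hankelDet_jacobiMoment, Finset.prod_range_succ, coeffProd_succ, Nat.cast_add_one]
    ring
  · rw [hankelDetTilde_jacobiMoment, hankelDetTilde_jacobiMoment, mul_div_cancel_left₀ _ (hne _),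
      mul_div_cancel_left₀ _ (hne _), Finset.sum_range_succ, add_sub_cancel_left]

variable {a b} in
theorem givenByHankel_iff {μ : ℕ → K} :
    GivenByHankel μ a b ↔
      μ 0 ≠ 0 ∧ (∀ n : ℕ, a (n + 1) ≠ 0) ∧ μ = μ 0 • jacobiMoment a b := by
  constructor
  · intro h
    have h₀ : μ 0 ≠ 0 := hankelDet_one μ ▸ h.1 1
    have hJ := (givenByHankel_jacobiMoment b h.coeff_ne_zero).smul h₀
    exact ⟨h₀, h.coeff_ne_zero, h.unique hJ (by simp [jacobiMoment_zero])⟩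
  · rintro ⟨h₀, ha, hμ⟩
    rw [hμ]
    exact (givenByHankel_jacobiMoment b ha).smul h₀

end Hankel

section Pearson

section CommRing

variable {R : Type*} [CommRing R]

/-- The linear functional on polynomials with moments `μ`, that is, `X ^ k ↦ μ k`; for moments
`μ k = ∫ x ^ k dw` it is `f ↦ ∫ f dw`. -/
def momentFunctional (μ : ℕ → R) : R[X] →ₗ[R] R :=
  (basisMonomials R).constr R μ

theorem momentFunctional_X_pow (μ : ℕ → R) (k : ℕ) : momentFunctional μ (X ^ k) = μ k := by
  rw [← monomial_one_right_eq_X_pow]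
  exact (basisMonomials R).constr_basis R μ k

theorem linearMap_ext_X_pow {M : Type*} [AddCommGroup M] [Module R M] {φ ψ : R[X] →ₗ[R] M}
    (h : ∀ k, φ (X ^ k) = ψ (X ^ k)) : φ = ψ :=
  lhom_ext' fun k => LinearMap.ext_ring (by simpa [monomial_one_right_eq_X_pow] using h k)

/-- The defect `f ↦ Λ (Q f) - Λ (f')` in the Pearson equation of the functional `Λ` with moments
`μ`. For the weight `exp (-P)` and `Q = P'` it vanishes by integration by parts. -/
def pearsonDefect (Q : R[X]) (μ : ℕ → R) : R[X] →ₗ[R] R :=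
  momentFunctional μ ∘ₗ LinearMap.mulLeft R Q - momentFunctional μ ∘ₗ derivative

theorem pearsonDefect_apply (Q : R[X]) (μ : ℕ → R) (f : R[X]) :
    pearsonDefect Q μ f = momentFunctional μ (Q * f) - momentFunctional μ (derivative f) :=
  rfl

theorem pearsonDefect_eq_zero_iff {Q : R[X]} {μ : ℕ → R} :
    pearsonDefect Q μ = 0 ↔ ∀ k, pearsonDefect Q μ (X ^ k) = 0 :=
  ⟨fun h k => by rw [h, LinearMap.zero_apply], fun h => linearMap_ext_X_pow h⟩

variable (a : ℤ → R) (b : ℕ → R)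

/-- The monic orthogonal polynomials of the Jacobi matrix, given by their three-term recurrence. -/
def orthoPoly : ℕ → R[X]
  | 0 => 1
  | 1 => X - C (b 0)
  | n + 2 => (X - C (b (n + 1))) * orthoPoly (n + 1) - C (a (n + 1) ^ 2) * orthoPoly n

variable [Nontrivial R]

theorem monic_orthoPoly_and_natDegree (n : ℕ) :
    (orthoPoly a b n).Monic ∧ (orthoPoly a b n).natDegree = n := by
  induction n using Nat.twoStepInduction with
  | zero => exact ⟨monic_one, natDegree_one⟩
  | one => exact ⟨monic_X_sub_C _, natDegree_X_sub_C _⟩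
  | more n ih₁ ih₂ =>
    have hmonic := (monic_X_sub_C (b (n + 1))).mul ih₂.1
    have hdeg : ((X - C (b (n + 1))) * orthoPoly a b (n + 1)).natDegree = n + 2 := by
      rw [(monic_X_sub_C _).natDegree_mul ih₂.1, natDegree_X_sub_C, ih₂.2, add_comm 1]
    have hlt : (C (a (n + 1) ^ 2) * orthoPoly a b n).natDegree <
        ((X - C (b (n + 1))) * orthoPoly a b (n + 1)).natDegree :=
      (natDegree_C_mul_le _ _).trans_lt (by omega)
    rw [orthoPoly]
    exact ⟨hmonic.sub_of_left (degree_lt_degree hlt),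
      (natDegree_sub_eq_left_of_natDegree_lt hlt).trans hdeg⟩

theorem monic_orthoPoly (n : ℕ) : (orthoPoly a b n).Monic :=
  (monic_orthoPoly_and_natDegree a b n).1

theorem natDegree_orthoPoly (n : ℕ) : (orthoPoly a b n).natDegree = n :=
  (monic_orthoPoly_and_natDegree a b n).2

/-- The products `p 0 * p 0, p 0 * p 1, p 1 * p 1, p 1 * p 2, …` of consecutive orthogonal
polynomials. They serve as a basis of test polynomials for the Pearson defect. -/
def orthoPolyProd : Polynomial.Sequence R where
  elems' k := orthoPoly a b (k / 2) * orthoPoly a b ((k + 1) / 2)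
  degree_eq' k := by
    have hmonic := monic_orthoPoly a b
    rw [degree_eq_natDegree ((hmonic _).mul (hmonic _)).ne_zero,
      (hmonic _).natDegree_mul (hmonic _), natDegree_orthoPoly, natDegree_orthoPoly,
      show k / 2 + (k + 1) / 2 = k by omega]

theorem span_orthoPolyProd : Submodule.span R (Set.range (orthoPolyProd a b)) = ⊤ :=
  (orthoPolyProd a b).span fun _ =>
    ((monic_orthoPoly a b _).mul (monic_orthoPoly a b _)).leadingCoeff ▸ isUnit_one

end CommRing

variable {K : Type*} [Field K]

theorem derivative_evenPoly (m : ℕ) (c : ℕ → K) :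
    derivative (evenPoly m c) =
      ∑ i ∈ range m, (((2 * (m - i) : ℕ) : K) * c i) • X ^ (2 * (m - i) - 1) := by
  rw [evenPoly, derivative_sum, Finset.sum_range_succ]
  simp only [derivative_C_mul, derivative_X_pow, Nat.sub_self, mul_zero, Nat.cast_zero, map_zero,
    zero_mul, add_zero, smul_eq_C_mul, C_mul]
  exact Finset.sum_congr rfl fun i _ => by ring

theorem pearsonDefect_derivative_evenPoly (m : ℕ) (c μ : ℕ → K) (k : ℕ) :
    pearsonDefect (derivative (evenPoly m c)) μ (X ^ k) =
      ∑ i ∈ range m, ((2 * (m - i) : ℕ) : K) * c i * μ (2 * (m - i) - 1 + k) -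
        k * μ (k - 1) := by
  rw [pearsonDefect_apply, derivative_evenPoly, Finset.sum_mul, map_sum, derivative_X_pow,
    ← smul_eq_C_mul, map_smul, momentFunctional_X_pow, smul_eq_mul]
  simp only [smul_mul_assoc, map_smul, ← pow_add, momentFunctional_X_pow, smul_eq_mul]

theorem momentRecurrence_iff {m : ℕ} {c μ : ℕ → K} (hμ : ∀ j, μ (2 * j + 1) = 0) :
    MomentRecurrence m c μ ↔ pearsonDefect (derivative (evenPoly m c)) μ = 0 := by
  have heven (n : ℕ) : pearsonDefect (derivative (evenPoly m c)) μ (X ^ (2 * n)) = 0 := by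
    have hodd {k : ℕ} (hk : Odd k) : μ k = 0 := by
      obtain ⟨j, rfl⟩ := hk
      exact hμ j
    rw [pearsonDefect_derivative_evenPoly, Finset.sum_eq_zero]
    · rcases n with _ | n
      · simp
      · rw [hodd (by grind), mul_zero, sub_zero]
    · intro i hi
      rw [hodd (by grind), mul_zero]
  have hodd (n : ℕ) : pearsonDefect (derivative (evenPoly m c)) μ (X ^ (2 * n + 1)) =
      ∑ i ∈ range m, ((2 * (m - i) : ℕ) : K) * c i * μ (2 * n + 2 * (m - i)) -
        (2 * n + 1) * μ (2 * n) := by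
    rw [pearsonDefect_derivative_evenPoly, Nat.add_sub_cancel]
    push_cast
    congr 1
    refine Finset.sum_congr rfl fun i hi => ?_
    congr 2
    grind
  rw [pearsonDefect_eq_zero_iff]
  constructor
  · rintro ⟨-, hrec⟩ k
    rcases Nat.even_or_odd' k with ⟨n, rfl | rfl⟩
    · exact heven n
    · rw [hodd, hrec, sub_self]
  · exact fun h => ⟨hμ, fun n => sub_eq_zero.1 ((hodd n).symm.trans (h _))⟩

theorem MomentRecurrence.smul {m : ℕ} {c μ : ℕ → K} (h : MomentRecurrence m c μ) (r : K) :
    MomentRecurrence m c (r • μ) := by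
  refine ⟨fun j => by simp [h.1 j], fun n => ?_⟩
  simp only [Pi.smul_apply, smul_eq_mul, mul_left_comm _ r, ← Finset.mul_sum, h.2 n]

variable (a : ℤ → K) (b : ℕ → K)

theorem momentFunctional_jacobiMoment (f : K[X]) :
    momentFunctional (jacobiMoment a b) f = entry (aeval (jacobi a b) f) 0 0 := by
  have hfun : momentFunctional (jacobiMoment a b) =
      Finsupp.lapply 0 ∘ₗ LinearMap.applyₗ (single 0 1) ∘ₗ (aeval (jacobi a b)).toLinearMap := by
    refine linearMap_ext_X_pow fun k => ?_
    simp [momentFunctional_X_pow, jacobiMoment, entry]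
  rw [hfun]
  rfl

theorem aeval_jacobi_orthoPoly (n : ℕ) :
    aeval (jacobi a b) (orthoPoly a b n) (single 0 1) = single n (coeffProd a n) := by
  induction n using Nat.twoStepInduction with
  | zero => simp [orthoPoly, coeffProd_zero]
  | one => simp [orthoPoly, jacobi_single_zero, coeffProd_succ, coeffProd_zero,
      Module.algebraMap_end_apply]
  | more n ih₁ ih₂ =>
    rw [orthoPoly, map_sub, map_mul, map_mul, map_sub, aeval_X, aeval_C, aeval_C,
      LinearMap.sub_apply, Module.End.mul_apply, Module.End.mul_apply, LinearMap.sub_apply, ih₁,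
      ih₂, jacobi_single_succ, Module.algebraMap_end_apply, Module.algebraMap_end_apply]
    simp only [Finsupp.smul_single, smul_eq_mul, coeffProd_succ, Nat.cast_add_one]
    rw [add_assoc, mul_comm (b _), mul_comm (a _ ^ 2), sq, ← mul_assoc]
    abel

theorem momentFunctional_jacobiMoment_mul_orthoPoly (f : K[X]) (n : ℕ) :
    momentFunctional (jacobiMoment a b) (f * orthoPoly a b n) =
      aeval (jacobi a b) f (single 0 1) n * coeffProd a n := by
  rw [momentFunctional_jacobiMoment, entry_aeval_jacobi_mul, aeval_jacobi_orthoPoly,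
    stdForm_single_right]

theorem momentFunctional_jacobiMoment_mul_orthoPoly_mul_orthoPoly (f : K[X]) (k n : ℕ) :
    momentFunctional (jacobiMoment a b) (f * (orthoPoly a b k * orthoPoly a b n)) =
      coeffProd a k * coeffProd a n * entry (aeval (jacobi a b) f) n k := by
  rw [← mul_assoc, momentFunctional_jacobiMoment_mul_orthoPoly, map_mul, Module.End.mul_apply,
    aeval_jacobi_orthoPoly, ← Finsupp.smul_single_one, map_smul, Finsupp.smul_apply, smul_eq_mul,
    mul_right_comm, entry]

theorem momentFunctional_jacobiMoment_mul_orthoPoly_of_natDegree_le {f : K[X]} {n : ℕ}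
    (hf : f.natDegree ≤ n) :
    momentFunctional (jacobiMoment a b) (f * orthoPoly a b n) = f.coeff n * coeffProd a n ^ 2 := by
  rw [momentFunctional_jacobiMoment_mul_orthoPoly, aeval_jacobi_single_zero_apply a b hf, sq,
    mul_assoc]

theorem momentFunctional_jacobiMoment_derivative_orthoPoly_mul {k n : ℕ} (hkn : k ≤ n) :
    momentFunctional (jacobiMoment a b) (derivative (orthoPoly a b k) * orthoPoly a b n) = 0 := by
  have hdeg := natDegree_orthoPoly a b k
  have hdeg' := natDegree_derivative_le (orthoPoly a b k)
  rw [momentFunctional_jacobiMoment_mul_orthoPoly_of_natDegree_le a b (by omega),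
    coeff_derivative, coeff_eq_zero_of_natDegree_lt (by omega), zero_mul, zero_mul]

theorem momentFunctional_jacobiMoment_derivative_orthoPoly_succ_mul (n : ℕ) :
    momentFunctional (jacobiMoment a b) (derivative (orthoPoly a b (n + 1)) * orthoPoly a b n) =
      (n + 1) * coeffProd a n ^ 2 := by
  have hdeg := natDegree_orthoPoly a b (n + 1)
  have hdeg' := natDegree_derivative_le (orthoPoly a b (n + 1))
  have hlead : (orthoPoly a b (n + 1)).coeff (n + 1) = 1 := by
    simpa only [hdeg] using (monic_orthoPoly a b (n + 1)).coeff_natDegree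
  rw [momentFunctional_jacobiMoment_mul_orthoPoly_of_natDegree_le a b (by omega),
    coeff_derivative, hlead, one_mul]

theorem pearsonDefect_orthoPoly_mul_self (Q : K[X]) (n : ℕ) :
    pearsonDefect Q (jacobiMoment a b) (orthoPoly a b n * orthoPoly a b n) =
      coeffProd a n ^ 2 * entry (aeval (jacobi a b) Q) n n := by
  rw [pearsonDefect_apply, momentFunctional_jacobiMoment_mul_orthoPoly_mul_orthoPoly,
    derivative_mul, mul_comm (orthoPoly a b n), map_add,
    momentFunctional_jacobiMoment_derivative_orthoPoly_mul a b le_rfl]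
  ring

theorem pearsonDefect_orthoPoly_mul_succ (Q : K[X]) (n : ℕ) :
    pearsonDefect Q (jacobiMoment a b) (orthoPoly a b n * orthoPoly a b (n + 1)) =
      coeffProd a n ^ 2 * (a (n + 1) * entry (aeval (jacobi a b) Q) (n + 1) n - (n + 1)) := by
  rw [pearsonDefect_apply, momentFunctional_jacobiMoment_mul_orthoPoly_mul_orthoPoly,
    derivative_mul, mul_comm (orthoPoly a b n), map_add,
    momentFunctional_jacobiMoment_derivative_orthoPoly_mul a b n.le_succ,
    momentFunctional_jacobiMoment_derivative_orthoPoly_succ_mul, coeffProd_succ]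
  ring

variable {a b} in
theorem pearsonDefect_jacobiMoment_eq_zero_iff (ha : ∀ n : ℕ, a (n + 1) ≠ 0) {Q : K[X]} :
    pearsonDefect Q (jacobiMoment a b) = 0 ↔
      ∀ n : ℕ, entry (aeval (jacobi a b) Q) n n = 0 ∧
        a (n + 1) * entry (aeval (jacobi a b) Q) (n + 1) n = n + 1 := by
  constructor
  · intro h n
    have hprod := pow_ne_zero 2 (coeffProd_ne_zero ha n)
    have hself := pearsonDefect_orthoPoly_mul_self a b Q n
    have hsucc := pearsonDefect_orthoPoly_mul_succ a b Q n
    rw [h, LinearMap.zero_apply, eq_comm, mul_eq_zero] at hself hsucc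
    exact ⟨hself.resolve_left hprod, sub_eq_zero.1 (hsucc.resolve_left hprod)⟩
  · intro h
    refine LinearMap.ext_on_range (span_orthoPolyProd a b) fun k => ?_
    change pearsonDefect Q _ (orthoPoly a b (k / 2) * orthoPoly a b ((k + 1) / 2)) = 0
    rcases Nat.even_or_odd' k with ⟨n, rfl | rfl⟩
    · rw [show 2 * n / 2 = n by omega, show (2 * n + 1) / 2 = n by omega,
        pearsonDefect_orthoPoly_mul_self, (h n).1, mul_zero]
    · rw [show (2 * n + 1) / 2 = n by omega, show (2 * n + 1 + 1) / 2 = n + 1 by omega,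
        pearsonDefect_orthoPoly_mul_succ, (h n).2, sub_self, mul_zero]

end Pearson

section Freud

variable {K : Type*} [Field K]

theorem entry_aeval_jacobi_derivative_evenPoly_self (a : ℤ → K) (m : ℕ) (c : ℕ → K) (n : ℕ) :
    entry (aeval (jacobi a 0) (derivative (evenPoly m c))) n n = 0 := by
  have hodd {i : ℕ} (hi : i ∈ range m) : (jacobi a 0 ^ (2 * (m - i) - 1)) (single n 1) n = 0 :=
    entry_jacobi_pow_eq_zero_of_odd a (by grind)
  rw [entry, derivative_evenPoly, map_sum, LinearMap.sum_apply, Finsupp.finsetSum_apply]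
  refine Finset.sum_eq_zero fun i hi => ?_
  rw [map_smul, aeval_X_pow, LinearMap.smul_apply, Finsupp.smul_apply, hodd hi, smul_zero]

theorem solvesFreud_iff {P : K[X]} {a : ℤ → K} :
    SolvesFreud P a ↔
      ∀ n : ℕ, a (n + 1) * entry (aeval (jacobi a 0) (derivative P)) (n + 1) n = n + 1 := by
  refine ⟨fun h n => ?_, fun h n hn => ?_⟩
  · simpa [freudF] using h (n + 1) n.succ_pos
  · obtain ⟨n, rfl⟩ := Nat.exists_eq_add_of_le' hn
    simpa [freudF] using h n

theorem SolvesFreud.coeff_ne_zero [CharZero K] {P : K[X]} {a : ℤ → K} (h : SolvesFreud P a)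
    (n : ℕ) : a (n + 1) ≠ 0 :=
  left_ne_zero_of_mul (solvesFreud_iff.1 h n ▸ n.cast_add_one_ne_zero)

theorem solvesFreud_iff_momentRecurrence {m : ℕ} {c : ℕ → K} {a : ℤ → K}
    (ha : ∀ n : ℕ, a (n + 1) ≠ 0) :
    SolvesFreud (evenPoly m c) a ↔ MomentRecurrence m c (jacobiMoment a 0) := by
  rw [momentRecurrence_iff fun j => jacobiMoment_eq_zero_of_odd a (odd_two_mul_add_one j),
    pearsonDefect_jacobiMoment_eq_zero_iff ha, solvesFreud_iff]
  simp only [entry_aeval_jacobi_derivative_evenPoly_self, true_and]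

/-- The coefficient of `μ (2 * (n + i))` in the `n`-th equation of `MomentRecurrence m c μ`, once
all terms are on one side. -/
def momentCoeff (m : ℕ) (c : ℕ → K) (n : ℕ) : ℕ → K
  | 0 => -(2 * n + 1)
  | i + 1 => ((2 * (i + 1) : ℕ) : K) * c (m - (i + 1))

theorem momentRecurrence_iff_sum_momentCoeff {m : ℕ} {c μ : ℕ → K} :
    MomentRecurrence m c μ ↔ (∀ j, μ (2 * j + 1) = 0) ∧
      ∀ n, ∑ i ∈ range (m + 1), momentCoeff m c n i * μ (2 * (n + i)) = 0 := by
  refine and_congr_right fun _ => forall_congr' fun n => ?_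
  rw [Finset.sum_range_succ', ← Finset.sum_range_reflect, momentCoeff, neg_mul, add_zero,
    ← sub_eq_add_neg, sub_eq_zero]
  have hterm : ∀ i ∈ range m, ((2 * (m - (m - 1 - i)) : ℕ) : K) * c (m - 1 - i) *
      μ (2 * n + 2 * (m - (m - 1 - i))) = momentCoeff m c n (i + 1) * μ (2 * (n + (i + 1))) := by
    intro i hi
    have him := Finset.mem_range.1 hi
    rw [momentCoeff, show m - (m - 1 - i) = i + 1 by omega, show m - 1 - i = m - (i + 1) by omega,
      ← mul_add]
  rw [Finset.sum_congr rfl hterm]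

theorem initialMoments_iff {m : ℕ} (hm : 1 ≤ m) {a : ℤ → K} {μ : ℕ → K} {μ₀ : K} (h₀ : μ₀ ≠ 0) :
    μ 0 = μ₀ ∧ InitialMoments m a μ ↔ ∀ j < m, μ (2 * j) = μ₀ * jacobiMoment a 0 (2 * j) := by
  constructor
  · rintro ⟨rfl, hinit⟩ j hj
    rcases Nat.eq_zero_or_pos j with rfl | hpos
    · rw [mul_zero, jacobiMoment_zero, mul_one]
    · rw [jacobiMoment, ← hinit j hpos hj, mul_div_cancel₀ _ h₀]
  · intro h
    have hμ₀ : μ 0 = μ₀ := by simpa [jacobiMoment_zero] using h 0 hm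
    refine ⟨hμ₀, fun j _ hj => ?_⟩
    rw [h j hj, hμ₀, mul_div_cancel_left₀ _ h₀, jacobiMoment]

theorem existsUnique_moments [CharZero K] {m : ℕ} (hm : 1 ≤ m) {c : ℕ → K} (hc : c 0 ≠ 0)
    (a : ℤ → K) {μ₀ : K} (h₀ : μ₀ ≠ 0) :
    ∃! μ : ℕ → K, μ 0 = μ₀ ∧ MomentRecurrence m c μ ∧ InitialMoments m a μ := by
  have hlead (n : ℕ) : momentCoeff m c n m ≠ 0 := by
    obtain ⟨m, rfl⟩ := Nat.exists_eq_add_of_le' hm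
    rw [momentCoeff, Nat.sub_self]
    exact mul_ne_zero (Nat.cast_ne_zero.2 (by omega)) hc
  simp only [and_left_comm (a := _ = μ₀), initialMoments_iff hm h₀,
    momentRecurrence_iff_sum_momentCoeff]
  obtain ⟨s, ⟨hinit, hrec⟩, huniq⟩ :=
    existsUnique_linearRecurrence m (momentCoeff m c) hlead fun j => μ₀ * jacobiMoment a 0 (2 * j)
  have hs (j : ℕ) : 2 * j / 2 = j := by omega
  refine ⟨fun k => if Even k then s (k / 2) else 0, by simpa [hs] using ⟨hrec, hinit⟩, ?_⟩
  rintro μ ⟨⟨hodd, hμ⟩, hμinit⟩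
  have hμs := huniq (fun j => μ (2 * j)) ⟨hμinit, hμ⟩
  funext k
  rcases Nat.even_or_odd' k with ⟨n, rfl | rfl⟩
  · simpa using congrFun hμs n
  · simpa using hodd n

theorem eq_smul_jacobiMoment [CharZero K] {m : ℕ} (hm : 1 ≤ m) {c : ℕ → K} (hc : c 0 ≠ 0)
    {a : ℤ → K} {μ : ℕ → K} (h₀ : μ 0 ≠ 0) (hrec : MomentRecurrence m c μ)
    (hinit : InitialMoments m a μ) (hJ : MomentRecurrence m c (jacobiMoment a 0)) :
    μ = μ 0 • jacobiMoment a 0 := by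
  have hinitJ := (initialMoments_iff (μ := μ 0 • jacobiMoment a 0) hm h₀).2 fun j _ => rfl
  exact (existsUnique_moments hm hc a h₀).unique ⟨rfl, hrec, hinit⟩ ⟨hinitJ.1, hJ.smul _, hinitJ.2⟩

theorem solvesFreud_iff_givenByHankel [CharZero K] {m : ℕ} (hm : 1 ≤ m) {c : ℕ → K} (hc : c 0 ≠ 0)
    {a : ℤ → K} {μ : ℕ → K} (h₀ : μ 0 ≠ 0) (hrec : MomentRecurrence m c μ)
    (hinit : InitialMoments m a μ) :
    SolvesFreud (evenPoly m c) a ↔ GivenByHankel μ a 0 := by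
  rw [givenByHankel_iff]
  constructor
  · intro h
    have hJ := (solvesFreud_iff_momentRecurrence h.coeff_ne_zero).1 h
    exact ⟨h₀, h.coeff_ne_zero, eq_smul_jacobiMoment hm hc h₀ hrec hinit hJ⟩
  · rintro ⟨-, ha, hμ⟩
    have hJ : jacobiMoment a 0 = (μ 0)⁻¹ • μ := ((inv_smul_eq_iff₀ h₀).2 hμ).symm
    exact (solvesFreud_iff_momentRecurrence ha).2 (hJ ▸ hrec.smul _)

end Freud

end Freud

end

theorem theorem2 {K : Type*} [Field K] [CharZero K] (m : ℕ) (hm : 1 ≤ m)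
    (c : ℕ → K) (hc : c 0 ≠ 0)
    (a : ℤ → K) (ha : ∀ n : ℤ, -(m : ℤ) + 1 ≤ n → n ≤ 0 → a n = 0) :
    -- the moments exist and are determined by `μ 0` and the initial data
    (∀ μ₀ : K, μ₀ ≠ 0 → ∃! μ : ℕ → K,
      μ 0 = μ₀ ∧ Freud.MomentRecurrence m c μ ∧ Freud.InitialMoments m a μ) ∧
    -- only `a 1, …, a (m-1)` enter the initial moments
    (∀ a' : ℤ → K, (∀ n : ℤ, 1 ≤ n → n < m → a' n = a n) →
      ∀ j : ℕ, j < m → Freud.entry (Freud.jacobi a' 0 ^ (2 * j)) 0 0 =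
        Freud.entry (Freud.jacobi a 0 ^ (2 * j)) 0 0) ∧
    -- the solution of Freud's equations is the one given by the determinants of these moments
    (∀ μ : ℕ → K, μ 0 ≠ 0 → Freud.MomentRecurrence m c μ → Freud.InitialMoments m a μ →
      (Freud.SolvesFreud (Freud.evenPoly m c) a ↔ Freud.GivenByHankel μ a 0)) := by
  refine ⟨fun μ₀ h₀ => Freud.existsUnique_moments hm hc a h₀, fun a' ha' j hj => ?_,
    fun μ h₀ hrec hinit => Freud.solvesFreud_iff_givenByHankel hm hc h₀ hrec hinit⟩
  exact Freud.jacobiMoment_two_mul_congr (fun n hn => ha' (n + 1) (by omega) (by omega))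
    fun _ _ => rfl
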